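/- Let $\ell:\mathbb R^d\times\mathcal X\to\mathbb R$ be a loss, differentiable in its first argument, $K\subseteq\mathbb R^d$ a nonempty closed convex set with metric projection $\Pi_K$, $q\in[0,1]$ a sampling rate, $\sigma>0$, $(\eta_t)_{t\ge0}$ real step sizes, and $\nu_0$ a probability measure on $\mathbb R^d$. For a finite set $\mathcal D\subseteq\mathcal X$, projected noisy (sub-sampled Gaussian) gradient descent on $\mathcal D$ starts from $w_0\sim\nu_0$ and iterates $$w_{t+1}=\Pi_K\Big(w_t-\eta_t\Big(\sum_{y\in B_t}\nabla_w\ell(w_t,y)+\xi_t\Big)\Big),\qquad \xi_t\sim N(0,\sigma^2 I_d),$$ where the batch $B_t\subseteq\mathcal D$ contains each point of $\mathcal D$ independently with probability $q$, and all batches and noises are independent of each other and of $w_0$. Let $\nu_{t,\mathcal D}$ be the law of $w_t$. For $\alpha>1$ and $\mu\ll\nu$ let $D_\alpha(\mu\|\nu)=\frac1{\alpha-1}\log\int(\frac{d\mu}{d\nu})^\alpha\,d\nu\in[0,\infty]$. Let $T\ge0$ be an integer, $p=3T$, $o_p(\alpha)=\frac p{p-1}\alpha-\frac1p$, and let $n_t=\lceil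 o_p^t(\alpha)\rceil$, where $o_p^t$ is $o_p$ composed $t$ times. Put $$C_{t,\alpha}=\frac1{\alpha-1}\,\frac{(p-1)^{t+1}}{p^{t+1}},\qquad f_{t,\alpha}(g)=\Big(\sum_{k=0}^{n_t}\binom{n_t}{k}q^k(1-q)^{n_t-k}e^{g^2(k^2-k)/(2\sigma^2)}\Big)^p ,$$ and define the per-instance privacy loss of $x\in\mathcal D$ (an element of $[0,\infty]$) by $$P(x,\alpha)=\sum_{t=1}^{T}C_{t,\alpha}\,\ln\mathbb E_{w\sim\nu_{T-t,\mathcal D}}\,f_{t,\alpha}\big(\|\nabla_w\ell(w,x)\|_2\big).$$ Theorem. For every finite dataset $\mathcal D$, every $x\in\mathcal D$ and every real $\alpha>1$, we have $\nu_{T,\mathcal D}\ll\nu_{T,\mathcal D\setminus\{x\}}$ and $$D_\alpha\big(\nu_{T,\mathcal D}\,\big\|\,\nu_{T,\mathcal D\setminus\{x\}}\big)\le P(x,\alpha).$$ -/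

import Mathlib

open MeasureTheory ProbabilityTheory
open scoped ENNReal Gradient

noncomputable section

namespace PerInstance

/-- The Rényi divergence `D_α(μ ‖ ν) = (α - 1)⁻¹ log ∫ (dμ/dν)^α dν` of order `α > 1`,
with values in the extended reals; it is `⊤` when `μ` is not absolutely continuous
with respect to `ν`. -/
def renyiDiv {Ω : Type*} [MeasurableSpace Ω] (α : ℝ) (μ ν : Measure Ω) : EReal :=
  open Classical in
  if μ ≪ ν then
    ((1 / (α - 1) : ℝ) : EReal) * ENNReal.log (∫⁻ x, (μ.rnDeriv ν x) ^ α ∂ν)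
  else ⊤

/-- The metric projection onto `K`: a nearest point of `K` (it exists and is unique when `K` is
nonempty, closed and convex). -/
def proj {d : ℕ} (K : Set (EuclideanSpace ℝ (Fin d))) (w : EuclideanSpace ℝ (Fin d)) :
    EuclideanSpace ℝ (Fin d) :=
  open Classical in
  if h : ∃ v ∈ K, ∀ u ∈ K, dist w v ≤ dist w u then h.choose else w

/-- The law of the next iterate of projected noisy gradient descent on the dataset `D`, from the
current weights `w`. Poisson sub-sampling puts every point of `D` into the batch `B`
independently with probability `q`; then
`w⁺ = Π_K (w - η (∑_{x ∈ B} ∇_w ℓ(w, x) + σ z))` with `z ∼ N(0, I_d)`. -/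
def stepLaw {d : ℕ} {X : Type*} (ℓ : EuclideanSpace ℝ (Fin d) → X → ℝ)
    (K : Set (EuclideanSpace ℝ (Fin d))) (q σ η : ℝ) (D : Finset X)
    (w : EuclideanSpace ℝ (Fin d)) : Measure (EuclideanSpace ℝ (Fin d)) :=
  ∑ B ∈ D.powerset, ENNReal.ofReal (q ^ B.card * (1 - q) ^ (D.card - B.card)) •
    (stdGaussian (EuclideanSpace ℝ (Fin d))).map
      (fun z => proj K (w - η • ((∑ x ∈ B, ∇ (fun v => ℓ v x) w) + σ • z)))

/-- `iterLaw … D t` is `ν_{t,D}`, the law of the weights after `t` steps of projected noisy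
gradient descent on `D`, with initial law `ν₀` and step size `η t` in step `t + 1`. -/
def iterLaw {d : ℕ} {X : Type*} (ℓ : EuclideanSpace ℝ (Fin d) → X → ℝ)
    (K : Set (EuclideanSpace ℝ (Fin d))) (q σ : ℝ) (η : ℕ → ℝ)
    (ν₀ : Measure (EuclideanSpace ℝ (Fin d))) (D : Finset X) :
    ℕ → Measure (EuclideanSpace ℝ (Fin d))
  | 0 => ν₀
  | t + 1 => (iterLaw ℓ K q σ η ν₀ D t).bind (stepLaw ℓ K q σ (η t) D)

/-- `o_p(α) = p / (p - 1) * α - 1 / p`. -/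
def orderMap (p α : ℝ) : ℝ := p / (p - 1) * α - 1 / p

/-- `o_p^t(α)`, the `t`-fold composition of `o_p` at `α`, rounded up to an integer. -/
def order (p α : ℝ) (t : ℕ) : ℕ := ⌈(orderMap p)^[t] α⌉₊

/-- `f_{t,α}(g) = (∑_{k=0}^n (n choose k) q^k (1-q)^(n-k) exp(g² (k² - k) / (2σ²)))^p`
with `n = o_p^t(α)`. -/
def stepMoment (p q σ α : ℝ) (t : ℕ) (g : ℝ) : ℝ :=
  (∑ k ∈ Finset.range (order p α t + 1),
    ((order p α t).choose k : ℝ) * q ^ k * (1 - q) ^ (order p α t - k) *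
      Real.exp (g ^ 2 * ((k : ℝ) ^ 2 - k) / (2 * σ ^ 2))) ^ p

/-- `C_{t,α} = (α - 1)⁻¹ (p - 1)^(t+1) / p^(t+1)`. -/
def stepCoeff (p α : ℝ) (t : ℕ) : ℝ := 1 / (α - 1) * ((p - 1) ^ (t + 1) / p ^ (t + 1))

/-- The per-instance privacy loss
`P(x, α) = ∑_{t=1}^T C_{t,α} log E_{w ∼ ν_{T-t,D}} f_{t,α}(‖∇_w ℓ(w, x)‖)` with `p = 3T`:
the summand `t` is evaluated at the weights at which the `t`-th step from the end takes its
gradients. It is `⊤` when one of the expectations is infinite. -/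
def privacyLoss {d : ℕ} {X : Type*} (ℓ : EuclideanSpace ℝ (Fin d) → X → ℝ)
    (K : Set (EuclideanSpace ℝ (Fin d))) (q σ : ℝ) (η : ℕ → ℝ)
    (ν₀ : Measure (EuclideanSpace ℝ (Fin d))) (D : Finset X) (T : ℕ) (x : X) (α : ℝ) : EReal :=
  ∑ t ∈ Finset.Icc 1 T, (stepCoeff (3 * T) α t : EReal) *
    ENNReal.log (∫⁻ w, ENNReal.ofReal
      (stepMoment (3 * T) q σ α t ‖∇ (fun v => ℓ v x) w‖) ∂(iterLaw ℓ K q σ η ν₀ D (T - t)))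

end PerInstance

end

/-! Both chains are compared on one space: weights, a batch `B` drawn from `D \ {x}`, and Gaussian
noise. A batch from `D` is `B` or `insert x B`, and inserting `x` only translates the noise by `σ⁻¹
• ∇ℓ(w, x)` (`stepMap_insert`). By Cameron-Martin, a step on `D` is therefore the step on `D \ {x}`
driven by noise with density `mixDensity` (`bind_stepLaw_insert`).

Let `μ`, `ν` be the current laws with and without `x`, and `r = dμ/dν`. Data processing bounds the
next `α`-moment by `∫ r^α M dν = ∫ r^(α-1) M dμ`, where `M` is the sub-sampled Gaussian moment.
Hölder under `μ` with exponents `p` and `p/(p-1)` separates `M` from `r` (`noisyStep_bound`). Taking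
logarithms, `D_α(next) ≤ log E_μ[M^p] / ((α-1)p) + D_α'(now)`, with `α' = 1 + (α-1)p/(p-1)`.

Induction over the steps, for all orders at once, gives the sum (`renyiDiv_iterLaw_insert_le`). The
stated constants leave slack: `α' ≤ o_p(α)`, `1/p ≤ ((p-1)/p)²` for `p ≥ 3`, and moments of a
probability density increase with the order, so orders may be rounded up. -/

noncomputable section

namespace PerInstance

/-! ### Metric projection onto a closed convex set -/

section Projection

variable {d : ℕ} {K : Set (EuclideanSpace ℝ (Fin d))}

theorem proj_spec (hne : K.Nonempty) (hcl : IsClosed K) (w : EuclideanSpace ℝ (Fin d)) :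
    proj K w ∈ K ∧ ∀ u ∈ K, dist w (proj K w) ≤ dist w u := by
  have h : ∃ v ∈ K, ∀ u ∈ K, dist w v ≤ dist w u := by
    obtain ⟨v, hv, hdist⟩ := hcl.exists_infDist_eq_dist hne w
    exact ⟨v, hv, fun u hu => hdist ▸ Metric.infDist_le_dist_of_mem hu⟩
  rw [proj, dif_pos h]
  exact h.choose_spec

theorem inner_sub_proj_le_zero (hne : K.Nonempty) (hcl : IsClosed K) (hconv : Convex ℝ K)
    (w : EuclideanSpace ℝ (Fin d)) {u : EuclideanSpace ℝ (Fin d)} (hu : u ∈ K) :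
    inner ℝ (w - proj K w) (u - proj K w) ≤ 0 := by
  obtain ⟨hmem, hmin⟩ := proj_spec hne hcl w
  have : Nonempty K := hne.to_subtype
  refine (norm_eq_iInf_iff_real_inner_le_zero hconv hmem).1 (le_antisymm ?_ ?_) u hu
  · exact le_ciInf fun v => by simpa [dist_eq_norm] using hmin v v.2
  · exact ciInf_le ⟨0, by rintro _ ⟨v, rfl⟩; positivity⟩ (⟨_, hmem⟩ : K)

/-- Add the variational inequalities at the two projections and apply Cauchy-Schwarz. Only the
resulting measurability is needed later. -/
theorem lipschitzWith_proj (hne : K.Nonempty) (hcl : IsClosed K) (hconv : Convex ℝ K) :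
    LipschitzWith 1 (proj K) := by
  refine LipschitzWith.of_dist_le_mul fun u v => ?_
  have h₁ := inner_sub_proj_le_zero hne hcl hconv u (proj_spec hne hcl v).1
  have h₂ := inner_sub_proj_le_zero hne hcl hconv v (proj_spec hne hcl u).1
  have h₃ : inner ℝ (proj K u - proj K v) (proj K u - proj K v)
      ≤ inner ℝ (u - v) (proj K u - proj K v) := by
    simp only [inner_sub_left, inner_sub_right] at h₁ h₂ ⊢
    linarith
  rw [real_inner_self_eq_norm_sq] at h₃
  have h₄ := h₃.trans (real_inner_le_norm _ _)
  rw [NNReal.coe_one, one_mul, dist_eq_norm, dist_eq_norm]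
  by_contra! hlt
  nlinarith [norm_nonneg (u - v)]

theorem measurable_proj (hne : K.Nonempty) (hcl : IsClosed K) (hconv : Convex ℝ K) :
    Measurable (proj K) :=
  (lipschitzWith_proj hne hcl hconv).continuous.measurable

end Projection

/-! ### Translates of the standard Gaussian and their densities -/

section GaussianShift

variable {d : ℕ}

/-- The density of `N(a, I)` with respect to `N(0, I)`. -/
def shiftDensity (a z : EuclideanSpace ℝ (Fin d)) : ℝ≥0∞ :=
  ENNReal.ofReal (Real.exp (inner ℝ a z - ‖a‖ ^ 2 / 2))

theorem measurable_shiftDensity :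
    Measurable fun p : EuclideanSpace ℝ (Fin d) × EuclideanSpace ℝ (Fin d) =>
      shiftDensity p.1 p.2 := by
  unfold shiftDensity
  fun_prop

/-- Complex coefficients let one formula give both the exponential moments and the characteristic
function of the tilted measure. -/
theorem integral_cexp_sum_stdGaussian (c : Fin d → ℂ) :
    ∫ z, Complex.exp (∑ i, c i * (z i : ℂ)) ∂(stdGaussian (EuclideanSpace ℝ (Fin d)))
      = Complex.exp (∑ i, c i ^ 2 / 2) := by
  rw [← map_pi_eq_stdGaussian, integral_map (by fun_prop) (by fun_prop)]
  simp only [Complex.exp_sum]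
  rw [integral_fintype_prod_eq_prod (fun i (y : ℝ) => Complex.exp (c i * y))]
  refine Finset.prod_congr rfl fun i _ => ?_
  simpa [complexMGF] using complexMGF_id_gaussianReal (μ := 0) (v := 1) (c i)

theorem integral_exp_inner_stdGaussian (a : EuclideanSpace ℝ (Fin d)) :
    ∫ z, Real.exp (inner ℝ a z) ∂(stdGaussian (EuclideanSpace ℝ (Fin d)))
      = Real.exp (‖a‖ ^ 2 / 2) := by
  have h := integral_cexp_sum_stdGaussian (fun i => (a i : ℂ))
  have h₁ : ∀ z : EuclideanSpace ℝ (Fin d),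
      Complex.exp (∑ i, (a i : ℂ) * (z i : ℂ)) = ((Real.exp (inner ℝ a z) : ℝ) : ℂ) := by
    intro z
    simp [PiLp.inner_apply, mul_comm]
  simp only [h₁] at h
  rw [integral_complex_ofReal] at h
  apply_fun Complex.re at h
  rw [Complex.ofReal_re] at h
  rw [h, EuclideanSpace.norm_sq_eq, Finset.sum_div]
  have h₂ : (∑ i, (a i : ℂ) ^ 2 / 2) = ((∑ i, ‖a i‖ ^ 2 / 2 : ℝ) : ℂ) := by
    push_cast
    refine Finset.sum_congr rfl fun i _ => ?_
    rw [← Complex.ofReal_pow, ← Complex.ofReal_pow, Real.norm_eq_abs, sq_abs]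
  rw [h₂, ← Complex.ofReal_exp, Complex.ofReal_re]

/-- A non-integrable function would have Bochner integral zero, but the integral is a positive
exponential. -/
theorem integrable_exp_inner_stdGaussian (a : EuclideanSpace ℝ (Fin d)) :
    Integrable (fun z => Real.exp (inner ℝ a z)) (stdGaussian (EuclideanSpace ℝ (Fin d))) := by
  by_contra h
  have := integral_exp_inner_stdGaussian a
  rw [integral_undef h] at this
  exact (Real.exp_pos _).ne this

theorem withDensity_shiftDensity_eq_tilted (a : EuclideanSpace ℝ (Fin d)) :
    (stdGaussian (EuclideanSpace ℝ (Fin d))).withDensity (shiftDensity a)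
      = (stdGaussian (EuclideanSpace ℝ (Fin d))).tilted (fun z => inner ℝ a z) := by
  rw [Measure.tilted, integral_exp_inner_stdGaussian]
  congr 1 with z
  rw [shiftDensity, Real.exp_sub]

/-- The Cameron-Martin formula for the standard Gaussian measure. -/
theorem map_add_const_stdGaussian (a : EuclideanSpace ℝ (Fin d)) :
    (stdGaussian (EuclideanSpace ℝ (Fin d))).map (fun z => z + a)
      = (stdGaussian (EuclideanSpace ℝ (Fin d))).withDensity (shiftDensity a) := by
  rw [withDensity_shiftDensity_eq_tilted]
  have := isProbabilityMeasure_tilted (integrable_exp_inner_stdGaussian a)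
  refine Measure.ext_of_charFun (funext fun t => ?_)
  rw [charFun_map_add_const, charFun_stdGaussian, charFun_apply, integral_tilted,
    integral_exp_inner_stdGaussian]
  have h₁ : ∀ z : EuclideanSpace ℝ (Fin d),
      (Real.exp (inner ℝ a z) / Real.exp (‖a‖ ^ 2 / 2)) • Complex.exp (inner ℝ z t * Complex.I)
        = Complex.exp (-((‖a‖ ^ 2 / 2 : ℝ) : ℂ)) *
          Complex.exp (∑ i, ((a i : ℂ) + t i * Complex.I) * (z i : ℂ)) := by
    intro z
    rw [← Real.exp_sub, Complex.real_smul, Complex.ofReal_exp, ← Complex.exp_add, ← Complex.exp_add]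
    congr 1
    simp only [PiLp.inner_apply, add_mul, Finset.sum_add_distrib, Complex.ofReal_sub,
      Complex.ofReal_sum, Finset.sum_mul]
    simp only [RCLike.inner_apply, conj_trivial, Complex.ofReal_mul]
    rw [sub_add_eq_add_sub, ← neg_add_eq_sub]
    congr 2
    · exact Finset.sum_congr rfl fun i _ => by ring
    · exact Finset.sum_congr rfl fun i _ => by ring
  simp only [h₁]
  rw [integral_const_mul, integral_cexp_sum_stdGaussian, ← Complex.exp_add, ← Complex.exp_add]
  congr 1
  have h₂ : ∀ b : EuclideanSpace ℝ (Fin d), ((‖b‖ : ℂ)) ^ 2 = ∑ i, (b i : ℂ) ^ 2 := by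
    intro b
    rw [← Complex.ofReal_pow, EuclideanSpace.norm_sq_eq]
    push_cast
    refine Finset.sum_congr rfl fun i _ => ?_
    rw [← Complex.ofReal_pow, ← Complex.ofReal_pow, Real.norm_eq_abs, sq_abs]
  push_cast
  rw [h₂, h₂, PiLp.inner_apply]
  simp only [RCLike.inner_apply, conj_trivial]
  push_cast
  rw [← Finset.sum_neg_distrib, Finset.sum_div, Finset.sum_div, Finset.sum_mul,
    ← Finset.sum_neg_distrib, ← Finset.sum_add_distrib, ← Finset.sum_add_distrib]
  refine Finset.sum_congr rfl fun i _ => ?_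
  -- Coordinatewise, `(a + ti)²/2 - a²/2 = ati - t²/2`.
  linear_combination (-(t i : ℂ) ^ 2 / 2) * Complex.I_sq

theorem lintegral_shiftDensity (a : EuclideanSpace ℝ (Fin d)) :
    ∫⁻ z, shiftDensity a z ∂(stdGaussian (EuclideanSpace ℝ (Fin d))) = 1 := by
  have h := congrArg (fun m : Measure _ => m Set.univ) (map_add_const_stdGaussian a)
  simp only [withDensity_apply _ MeasurableSet.univ, Measure.restrict_univ] at h
  rw [← h, Measure.map_apply (by fun_prop) MeasurableSet.univ, Set.preimage_univ, measure_univ]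

/-- Completing the square: the `k`-th power is a constant times the density of the shift by `k • a`,
which has total mass one. -/
theorem lintegral_shiftDensity_pow (a : EuclideanSpace ℝ (Fin d)) (k : ℕ) :
    ∫⁻ z, shiftDensity a z ^ k ∂(stdGaussian (EuclideanSpace ℝ (Fin d)))
      = ENNReal.ofReal (Real.exp (‖a‖ ^ 2 * ((k : ℝ) ^ 2 - k) / 2)) := by
  have h : ∀ z, shiftDensity a z ^ k
      = ENNReal.ofReal (Real.exp (‖a‖ ^ 2 * ((k : ℝ) ^ 2 - k) / 2)) *
        shiftDensity ((k : ℝ) • a) z := by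
    intro z
    rw [shiftDensity, shiftDensity, ← ENNReal.ofReal_pow (Real.exp_pos _).le,
      ← ENNReal.ofReal_mul (Real.exp_pos _).le, ← Real.exp_add, ← Real.exp_nat_mul,
      inner_smul_left, norm_smul]
    congr 2
    simp
    ring
  simp only [h]
  rw [lintegral_const_mul' _ _ ENNReal.ofReal_ne_top, lintegral_shiftDensity, mul_one]

end GaussianShift

/-! ### Moments of likelihood ratios -/

section Moments

variable {Ω : Type*} [MeasurableSpace Ω]

/-- The moments of order `≥ 1` of a probability density increase with the order. -/
theorem lintegral_rpow_mono_of_lintegral_eq_one {P : Measure Ω} [IsProbabilityMeasure P]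
    {h : Ω → ℝ≥0∞} (hm : AEMeasurable h P) (h1 : ∫⁻ ω, h ω ∂P = 1) {a b : ℝ} (ha : 1 ≤ a)
    (hab : a ≤ b) : ∫⁻ ω, h ω ^ a ∂P ≤ ∫⁻ ω, h ω ^ b ∂P := by
  -- Jensen for powers, as Hölder against the constant `1`.
  have jensen : ∀ {g : Ω → ℝ≥0∞} {c : ℝ}, AEMeasurable g P → 1 ≤ c →
      ∫⁻ ω, g ω ∂P ≤ (∫⁻ ω, g ω ^ c ∂P) ^ (1 / c) := by
    intro g c hg hc
    rcases hc.eq_or_lt with rfl | hc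
    · simp
    · have := ENNReal.lintegral_mul_le_Lp_mul_Lq P (Real.HolderConjugate.conjExponent hc) hg
        (aemeasurable_const (b := (1 : ℝ≥0∞)))
      simpa using this
  have hb : 1 ≤ b := ha.trans hab
  have ha0 : 0 < a := by linarith
  -- The moment is at least one, so the exponent `a / b ≤ 1` may be raised to `1` at the end.
  have hone : 1 ≤ ∫⁻ ω, h ω ^ b ∂P := by
    have := jensen hm hb
    rw [h1] at this
    by_contra! hlt
    exact absurd this (not_le.2 (ENNReal.rpow_lt_one hlt (by positivity)))
  have hc : 1 ≤ b / a := (one_le_div ha0).2 hab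
  calc ∫⁻ ω, h ω ^ a ∂P ≤ (∫⁻ ω, (h ω ^ a) ^ (b / a) ∂P) ^ (1 / (b / a)) :=
        jensen (hm.pow_const a) hc
    _ = (∫⁻ ω, h ω ^ b ∂P) ^ (1 / (b / a)) := by
        simp only [← ENNReal.rpow_mul, mul_div_cancel₀ _ ha0.ne']
    _ ≤ (∫⁻ ω, h ω ^ b ∂P) ^ (1 : ℝ) :=
        ENNReal.rpow_le_rpow_of_exponent_le hone (by rw [div_le_one (by positivity)]; exact hc)
    _ = _ := ENNReal.rpow_one _

/-- **Data processing inequality** for Rényi moments: the likelihood ratio of two push-forwards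
has smaller moments of order `α > 1` than the likelihood ratio upstairs. -/
theorem lintegral_rnDeriv_map_rpow_le {Ω' : Type*} [MeasurableSpace Ω'] {P : Measure Ω}
    [IsProbabilityMeasure P] {L : Ω → ℝ≥0∞} (hL : Measurable L) (hL1 : ∫⁻ ω, L ω ∂P ≠ ∞)
    {Y : Ω → Ω'} (hY : Measurable Y) {α : ℝ} (hα : 1 < α) :
    ∫⁻ y, (((P.withDensity L).map Y).rnDeriv (P.map Y) y) ^ α ∂(P.map Y)
      ≤ ∫⁻ ω, L ω ^ α ∂P := by
  set μ := (P.withDensity L).map Y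
  set ν := P.map Y
  have : IsProbabilityMeasure ν := Measure.isProbabilityMeasure_map hY.aemeasurable
  have : IsFiniteMeasure (P.withDensity L) := isFiniteMeasure_withDensity hL1
  have : IsFiniteMeasure μ := inferInstance
  have hac : μ ≪ ν := (withDensity_absolutelyContinuous P L).map hY
  set r := μ.rnDeriv ν
  have hr : Measurable r := Measure.measurable_rnDeriv μ ν
  have hα0 : 0 < α := by linarith
  have hconj := Real.HolderConjugate.conjExponent hα
  set β := α.conjExponent
  have hexp : (α - 1) * β = α := by
    have := hconj.sub_one_mul_conj
    linarith
  -- Test against the dual power of the ratio, truncated at `n` so that the moment `A` below is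
  -- finite and can be cancelled.
  set φ : ℕ → Ω' → ℝ≥0∞ := fun n y => (min (r y) n) ^ (α - 1)
  have hφ : ∀ n, Measurable (φ n) := fun n => (hr.min measurable_const).pow_const _
  have trunc : ∀ n : ℕ, ∫⁻ y, (min (r y) n) ^ α ∂ν ≤ ∫⁻ ω, L ω ^ α ∂P := by
    intro n
    set A := ∫⁻ y, (min (r y) n) ^ α ∂ν
    have hA : A ≠ ∞ := by
      refine ne_top_of_le_ne_top (b := (n : ℝ≥0∞) ^ α) (by finiteness) ?_
      calc A ≤ ∫⁻ _, (n : ℝ≥0∞) ^ α ∂ν :=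
            lintegral_mono fun y => ENNReal.rpow_le_rpow (min_le_right _ _) hα0.le
        _ = _ := by simp
    -- Hölder upstairs reproduces `A` on the right, because `φ n ^ β` is the `α`-th power of the
    -- truncated ratio.
    have h₁ : A ≤ (∫⁻ ω, L ω ^ α ∂P) ^ (1 / α) * A ^ (1 / β) := by
      calc A ≤ ∫⁻ y, (r * φ n) y ∂ν := by
            refine lintegral_mono fun y => ?_
            have : (min (r y) n) ^ α = (min (r y) n) * (min (r y) n) ^ (α - 1) := by
              conv_lhs => rw [show α = 1 + (α - 1) by ring]
              rw [ENNReal.rpow_add_of_nonneg _ _ zero_le_one (by linarith), ENNReal.rpow_one]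
            rw [this, Pi.mul_apply]
            gcongr
            exact min_le_left _ _
        _ = ∫⁻ y, φ n y ∂μ := by
            rw [← lintegral_withDensity_eq_lintegral_mul _ hr (hφ n),
              Measure.withDensity_rnDeriv_eq _ _ hac]
        _ = ∫⁻ ω, (L * fun ω => φ n (Y ω)) ω ∂P := by
            rw [lintegral_map (hφ n) hY,
              lintegral_withDensity_eq_lintegral_mul _ hL (g := fun ω => φ n (Y ω))
                ((hφ n).comp hY)]
        _ ≤ (∫⁻ ω, L ω ^ α ∂P) ^ (1 / α) * (∫⁻ ω, φ n (Y ω) ^ β ∂P) ^ (1 / β) :=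
            ENNReal.lintegral_mul_le_Lp_mul_Lq P hconj hL.aemeasurable
              ((hφ n).comp hY).aemeasurable
        _ = _ := by
            congr 2
            rw [← lintegral_map (f := fun y => φ n y ^ β) ((hφ n).pow_const β) hY]
            simp only [φ, ← ENNReal.rpow_mul, hexp]
            rfl
    rcases eq_or_ne A 0 with h0 | h0
    · rw [h0]; exact zero_le
    have hA' : A = A ^ (1 / α) * A ^ (1 / β) := by
      rw [← ENNReal.rpow_add _ _ h0 hA, one_div, one_div, hconj.inv_add_inv_eq_one,
        ENNReal.rpow_one]
    have hβ : A ^ (1 / β) ≠ 0 := by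
      simp [ENNReal.rpow_eq_zero_iff, h0, hA]
    have hβ' : A ^ (1 / β) ≠ ∞ :=
      ENNReal.rpow_ne_top_of_nonneg (by have := hconj.symm.pos; positivity) hA
    nth_rewrite 1 [hA'] at h₁
    rw [ENNReal.mul_le_mul_iff_left hβ hβ'] at h₁
    exact (ENNReal.rpow_le_rpow_iff (by positivity)).1 h₁
  have hsup : ∀ y, r y ^ α = ⨆ n : ℕ, (min (r y) n) ^ α := by
    intro y
    refine le_antisymm ?_ (iSup_le fun n => ENNReal.rpow_le_rpow (min_le_left _ _) hα0.le)
    rcases eq_or_ne (r y) ∞ with htop | htop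
    · have : (⨆ n : ℕ, (min (r y) n) ^ α) = (⨆ n : ℕ, (n : ℝ≥0∞)) ^ α := by
        simp only [htop, min_eq_right le_top]
        exact ((ENNReal.orderIsoRpow α hα0).map_iSup (fun n : ℕ => (n : ℝ≥0∞))).symm
      rw [this, ENNReal.iSup_natCast, htop]
    · obtain ⟨n, hn⟩ := ENNReal.exists_nat_gt htop
      exact le_iSup_of_le n (by rw [min_eq_left hn.le])
  calc ∫⁻ y, r y ^ α ∂ν = ∫⁻ y, ⨆ n : ℕ, (min (r y) n) ^ α ∂ν := lintegral_congr hsup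
    _ = ⨆ n : ℕ, ∫⁻ y, (min (r y) n) ^ α ∂ν := by
        refine lintegral_iSup (fun n => (hr.min measurable_const).pow_const _) ?_
        intro m n hmn y
        exact ENNReal.rpow_le_rpow (min_le_min le_rfl (by exact_mod_cast hmn)) hα0.le
    _ ≤ _ := iSup_le trunc

end Moments

/-! ### Moments of the sub-sampled Gaussian mechanism -/

section MixtureDensity

variable {d : ℕ}

/-- The density of the mixture `(1 - q) N(0, I) + q N(a, I)` with respect to `N(0, I)`. -/
def mixDensity (q : ℝ) (a z : EuclideanSpace ℝ (Fin d)) : ℝ≥0∞ :=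
  ENNReal.ofReal (1 - q) + ENNReal.ofReal q * shiftDensity a z

theorem measurable_mixDensity (q : ℝ) :
    Measurable fun p : EuclideanSpace ℝ (Fin d) × EuclideanSpace ℝ (Fin d) =>
      mixDensity q p.1 p.2 :=
  (measurable_shiftDensity.const_mul _).const_add _

theorem measurable_mixDensity_right (q : ℝ) (a : EuclideanSpace ℝ (Fin d)) :
    Measurable (mixDensity q a) := by
  unfold mixDensity shiftDensity
  fun_prop

theorem lintegral_mixDensity {q : ℝ} (hq0 : 0 ≤ q) (hq1 : q ≤ 1)
    (a : EuclideanSpace ℝ (Fin d)) :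
    ∫⁻ z, mixDensity q a z ∂(stdGaussian (EuclideanSpace ℝ (Fin d))) = 1 := by
  simp only [mixDensity]
  rw [lintegral_add_left measurable_const, lintegral_const_mul' _ _ ENNReal.ofReal_ne_top,
    lintegral_shiftDensity, lintegral_const, measure_univ, mul_one, mul_one,
    ← ENNReal.ofReal_add (by linarith) hq0]
  simp

/-- The `n`-th moment of the likelihood ratio of the sub-sampled Gaussian mechanism with
sampling rate `q` and noise level `σ`, for two outputs at distance `g`. -/
def binomialMoment (q σ : ℝ) (n : ℕ) (g : ℝ) : ℝ :=
  ∑ k ∈ Finset.range (n + 1), (n.choose k : ℝ) * q ^ k * (1 - q) ^ (n - k) *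
    Real.exp (g ^ 2 * ((k : ℝ) ^ 2 - k) / (2 * σ ^ 2))

theorem lintegral_mixDensity_pow {q : ℝ} (hq0 : 0 ≤ q) (hq1 : q ≤ 1) (σ : ℝ) (n : ℕ)
    (v : EuclideanSpace ℝ (Fin d)) :
    ∫⁻ z, mixDensity q (σ⁻¹ • v) z ^ n ∂(stdGaussian (EuclideanSpace ℝ (Fin d)))
      = ENNReal.ofReal (binomialMoment q σ n ‖v‖) := by
  have hm : Measurable (shiftDensity (σ⁻¹ • v)) := by
    unfold shiftDensity
    fun_prop
  have h1q : 0 ≤ 1 - q := by linarith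
  -- The summands are swapped so that the binomial index `k` counts factors of the shifted
  -- component.
  simp only [mixDensity, add_comm (ENNReal.ofReal (1 - q)), add_pow]
  rw [lintegral_finsetSum _ fun k _ => by fun_prop, binomialMoment,
    ENNReal.ofReal_sum_of_nonneg fun k _ => by positivity]
  refine Finset.sum_congr rfl fun k _ => ?_
  have : ∀ z, (ENNReal.ofReal q * shiftDensity (σ⁻¹ • v) z) ^ k * ENNReal.ofReal (1 - q) ^ (n - k)
      * (n.choose k : ℝ≥0∞) = ENNReal.ofReal ((n.choose k : ℝ) * q ^ k * (1 - q) ^ (n - k)) *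
        shiftDensity (σ⁻¹ • v) z ^ k := by
    intro z
    rw [ENNReal.ofReal_mul (by positivity), ENNReal.ofReal_mul (by positivity),
      ENNReal.ofReal_natCast, ENNReal.ofReal_pow hq0, ENNReal.ofReal_pow h1q]
    ring
  simp only [this]
  rw [lintegral_const_mul' _ _ ENNReal.ofReal_ne_top, lintegral_shiftDensity_pow,
    ← ENNReal.ofReal_mul (by positivity)]
  congr 3
  rw [norm_smul, mul_pow, norm_inv, Real.norm_eq_abs, inv_pow, sq_abs]
  field_simp

theorem lintegral_mixDensity_rpow_le {q : ℝ} (hq0 : 0 ≤ q) (hq1 : q ≤ 1) (σ : ℝ) {α : ℝ}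
    (hα : 1 ≤ α) {n : ℕ} (hn : α ≤ n) (v : EuclideanSpace ℝ (Fin d)) :
    ∫⁻ z, mixDensity q (σ⁻¹ • v) z ^ α ∂(stdGaussian (EuclideanSpace ℝ (Fin d)))
      ≤ ENNReal.ofReal (binomialMoment q σ n ‖v‖) := by
  rw [← lintegral_mixDensity_pow hq0 hq1]
  simp only [← ENNReal.rpow_natCast]
  exact lintegral_rpow_mono_of_lintegral_eq_one (measurable_mixDensity_right q _).aemeasurable
    (lintegral_mixDensity hq0 hq1 _) hα hn

end MixtureDensity

/-! ### One noisy step: data processing and Hölder -/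

section NoisyStep

variable {W Z W' : Type*} [MeasurableSpace W] [MeasurableSpace Z] [MeasurableSpace W']

/-- One step of a noisy iteration: if the noise of the first iteration has density `h (w, ·)` with
respect to the noise of the second, then absolute continuity is preserved, and the moment of order
`α` of the likelihood ratio is controlled by Hölder's inequality. -/
theorem noisyStep_bound {μ ν : Measure W} [IsProbabilityMeasure μ] [IsProbabilityMeasure ν]
    {P : Measure Z} [IsProbabilityMeasure P] (hac : μ ≪ ν) {Y : W × Z → W'} (hY : Measurable Y)
    {h : W × Z → ℝ≥0∞} (hh : Measurable h) (hh1 : ∀ w, ∫⁻ z, h (w, z) ∂P = 1)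
    {α p : ℝ} (hα : 1 < α) (hp : 1 < p) {M : W → ℝ≥0∞} (hM : Measurable M)
    (hhM : ∀ w, ∫⁻ z, h (w, z) ^ α ∂P ≤ M w) :
    ((μ.prod P).withDensity h).map Y ≪ (ν.prod P).map Y ∧
      ∫⁻ y, ((((μ.prod P).withDensity h).map Y).rnDeriv ((ν.prod P).map Y) y) ^ α
          ∂((ν.prod P).map Y)
        ≤ (∫⁻ w, M w ^ p ∂μ) ^ (1 / p) *
          (∫⁻ w, (μ.rnDeriv ν w) ^ (1 + (α - 1) * (p / (p - 1))) ∂ν) ^ ((p - 1) / p) := by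
  set r := μ.rnDeriv ν
  have hr : Measurable r := Measure.measurable_rnDeriv μ ν
  have hμ : ν.withDensity r = μ := Measure.withDensity_rnDeriv_eq _ _ hac
  have hr1 : Measurable fun a : W × Z => r a.1 := hr.comp measurable_fst
  -- Both new laws become images of densities over the same measure `ν.prod P`.
  have hdens : (μ.prod P).withDensity h = (ν.prod P).withDensity ((fun a : W × Z => r a.1) * h) := by
    rw [withDensity_mul _ hr1 hh, ← prod_withDensity_left hr, hμ]
  have hα0 : 0 ≤ α := by linarith
  rw [hdens]
  refine ⟨(withDensity_absolutelyContinuous _ _).map hY, ?_⟩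
  have hone : ∫⁻ a, ((fun a : W × Z => r a.1) * h) a ∂(ν.prod P) = 1 := by
    rw [lintegral_prod _ (hr1.mul hh).aemeasurable]
    have : ∀ w, ∫⁻ z, ((fun a : W × Z => r a.1) * h) (w, z) ∂P = r w := by
      intro w
      simp only [Pi.mul_apply]
      rw [lintegral_const_mul _ (by fun_prop), hh1, mul_one]
    simp only [this]
    rw [← setLIntegral_univ, ← withDensity_apply _ MeasurableSet.univ, hμ, measure_univ]
  have hconj := Real.HolderConjugate.conjExponent hp
  refine (lintegral_rnDeriv_map_rpow_le (hr1.mul hh) (by rw [hone]; exact ENNReal.one_ne_top)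
    hY hα).trans ?_
  calc ∫⁻ a, ((fun a : W × Z => r a.1) * h) a ^ α ∂(ν.prod P)
      = ∫⁻ w, r w ^ α * ∫⁻ z, h (w, z) ^ α ∂P ∂ν := by
        rw [lintegral_prod _ ((hr1.mul hh).pow_const α).aemeasurable]
        refine lintegral_congr fun w => ?_
        simp only [Pi.mul_apply, ENNReal.mul_rpow_of_nonneg _ _ hα0]
        rw [lintegral_const_mul _ (by fun_prop)]
    _ ≤ ∫⁻ w, r w ^ α * M w ∂ν := by
        gcongr with w
        exact hhM w
    -- One factor `r` is spent on passing from `ν` to `μ`, so that Hölder puts the expectation of `M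
    -- ^ p` under `μ`.
    _ = ∫⁻ w, (r * (M * fun w => r w ^ (α - 1))) w ∂ν := by
        refine lintegral_congr fun w => ?_
        have : r w ^ α = r w * r w ^ (α - 1) := by
          conv_lhs => rw [show α = 1 + (α - 1) by ring]
          rw [ENNReal.rpow_add_of_nonneg _ _ zero_le_one (by linarith), ENNReal.rpow_one]
        simp only [Pi.mul_apply, this]
        ring
    _ = ∫⁻ w, (M * fun w => r w ^ (α - 1)) w ∂μ := by
        rw [← lintegral_withDensity_eq_lintegral_mul _ hr (hM.mul (hr.pow_const _)), hμ]
    _ ≤ (∫⁻ w, M w ^ p ∂μ) ^ (1 / p) *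
          (∫⁻ w, (r w ^ (α - 1)) ^ (p / (p - 1)) ∂μ) ^ (1 / (p / (p - 1))) :=
        ENNReal.lintegral_mul_le_Lp_mul_Lq μ hconj hM.aemeasurable (hr.pow_const _).aemeasurable
    _ = _ := by
        rw [one_div_div]
        -- Returning to `ν` restores that factor: this is the `1 +` in the new order.
        have hint : ∫⁻ w, (r w ^ (α - 1)) ^ (p / (p - 1)) ∂μ
            = ∫⁻ w, (r * fun w => (r w ^ (α - 1)) ^ (p / (p - 1))) w ∂ν := by
          rw [← lintegral_withDensity_eq_lintegral_mul _ hr ((hr.pow_const _).pow_const _), hμ]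
        rw [hint]
        congr 2
        refine lintegral_congr fun w => ?_
        have : 0 ≤ (α - 1) * (p / (p - 1)) :=
          mul_nonneg (by linarith) (div_nonneg (by linarith) (by linarith))
        rw [Pi.mul_apply, ENNReal.rpow_add_of_nonneg _ _ zero_le_one this, ENNReal.rpow_one,
          ENNReal.rpow_mul]

end NoisyStep

/-! ### Gradient descent steps as images of a common noise -/

section Iteration

variable {d : ℕ} {X : Type*}

theorem measurable_gradient (f : EuclideanSpace ℝ (Fin d) → ℝ) : Measurable (∇ f) :=
  (InnerProductSpace.toDual ℝ (EuclideanSpace ℝ (Fin d))).symm.continuous.measurable.comp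
    (measurable_fderiv ℝ f)

/-- The next iterate, as a function of the batch `B`, the weights `w` and the noise `z`. -/
def stepMap (ℓ : EuclideanSpace ℝ (Fin d) → X → ℝ) (K : Set (EuclideanSpace ℝ (Fin d)))
    (σ η : ℝ) (B : Finset X) (w z : EuclideanSpace ℝ (Fin d)) : EuclideanSpace ℝ (Fin d) :=
  proj K (w - η • ((∑ x ∈ B, ∇ (fun v => ℓ v x) w) + σ • z))

/-- The probability that the batch drawn from `D` is `B`. -/
def batchWeight (q : ℝ) (D B : Finset X) : ℝ≥0∞ :=
  ENNReal.ofReal (q ^ B.card * (1 - q) ^ (D.card - B.card))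

theorem sum_batchWeight {q : ℝ} (hq0 : 0 ≤ q) (hq1 : q ≤ 1) (D : Finset X) :
    ∑ B ∈ D.powerset, batchWeight q D B = 1 := by
  have h1q : 0 ≤ 1 - q := by linarith
  simp only [batchWeight]
  rw [← ENNReal.ofReal_sum_of_nonneg fun B _ => by positivity, Finset.sum_pow_mul_eq_add_pow]
  simp

/-- The batches that can be drawn from `D`. -/
abbrev Batch (D : Finset X) : Type _ := {B : Finset X // B ∈ D.powerset}

instance (D : Finset X) : MeasurableSpace (Batch D) := ⊤

/-- The joint law of the batch and the noise. -/
def noiseLaw (d : ℕ) (q : ℝ) (D : Finset X) : Measure (Batch D × EuclideanSpace ℝ (Fin d)) :=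
  ∑ B : Batch D, batchWeight q D B • (stdGaussian (EuclideanSpace ℝ (Fin d))).map (Prod.mk B)

theorem lintegral_noiseLaw (q : ℝ) (D : Finset X)
    {f : Batch D × EuclideanSpace ℝ (Fin d) → ℝ≥0∞} (hf : Measurable f) :
    ∫⁻ b, f b ∂(noiseLaw d q D) = ∑ B : Batch D, batchWeight q D B *
      ∫⁻ z, f (B, z) ∂(stdGaussian (EuclideanSpace ℝ (Fin d))) := by
  rw [noiseLaw, lintegral_finsetSum_measure]
  refine Finset.sum_congr rfl fun B _ => ?_
  rw [lintegral_smul_measure, lintegral_map hf measurable_prodMk_left, smul_eq_mul]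

theorem lintegral_noiseLaw_snd {q : ℝ} (hq0 : 0 ≤ q) (hq1 : q ≤ 1) (D : Finset X)
    {f : EuclideanSpace ℝ (Fin d) → ℝ≥0∞} (hf : Measurable f) :
    ∫⁻ b, f b.2 ∂(noiseLaw d q D) = ∫⁻ z, f z ∂(stdGaussian (EuclideanSpace ℝ (Fin d))) := by
  rw [lintegral_noiseLaw q D (f := fun b => f b.2) (hf.comp measurable_snd)]
  dsimp only
  rw [← Finset.sum_mul, Finset.sum_coe_sort D.powerset (batchWeight q D), sum_batchWeight hq0 hq1,
    one_mul]

theorem isProbabilityMeasure_noiseLaw {q : ℝ} (hq0 : 0 ≤ q) (hq1 : q ≤ 1) (D : Finset X) :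
    IsProbabilityMeasure (noiseLaw d q D) := by
  refine ⟨?_⟩
  rw [← lintegral_one, lintegral_noiseLaw_snd hq0 hq1 D (f := fun _ => 1) measurable_const]
  simp

section

variable {K : Set (EuclideanSpace ℝ (Fin d))}

theorem measurable_stepMap (ℓ : EuclideanSpace ℝ (Fin d) → X → ℝ) (hproj : Measurable (proj K))
    (σ η : ℝ) (B : Finset X) :
    Measurable fun a : EuclideanSpace ℝ (Fin d) × EuclideanSpace ℝ (Fin d) =>
      stepMap ℓ K σ η B a.1 a.2 := by
  have hgrad : ∀ x, Measurable
      fun a : EuclideanSpace ℝ (Fin d) × EuclideanSpace ℝ (Fin d) => ∇ (fun v => ℓ v x) a.1 :=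
    fun x => (measurable_gradient _).comp measurable_fst
  refine hproj.comp (measurable_fst.sub (Measurable.const_smul (Measurable.add ?_ ?_) η))
  · exact Finset.measurable_fun_sum _ fun x _ => hgrad x
  · fun_prop

theorem measurable_stepMap_batch (ℓ : EuclideanSpace ℝ (Fin d) → X → ℝ)
    (hproj : Measurable (proj K)) (σ η : ℝ) (D : Finset X) :
    Measurable fun a : EuclideanSpace ℝ (Fin d) × (Batch D × EuclideanSpace ℝ (Fin d)) =>
      stepMap ℓ K σ η a.2.1 a.1 a.2.2 := by
  have h : Measurable fun a : (EuclideanSpace ℝ (Fin d) × EuclideanSpace ℝ (Fin d)) × Batch D =>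
      stepMap ℓ K σ η a.2 a.1.1 a.1.2 :=
    measurable_from_prod_countable_left fun B => measurable_stepMap ℓ hproj σ η B
  exact h.comp (f := fun a : EuclideanSpace ℝ (Fin d) × (Batch D × EuclideanSpace ℝ (Fin d)) =>
    ((a.1, a.2.2), a.2.1)) (by fun_prop)

theorem measurable_stepMap_right (ℓ : EuclideanSpace ℝ (Fin d) → X → ℝ)
    (hproj : Measurable (proj K)) (σ η : ℝ) (B : Finset X) (w : EuclideanSpace ℝ (Fin d)) :
    Measurable (stepMap ℓ K σ η B w) :=
  hproj.comp (by fun_prop)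

theorem measurable_stepMap_batch_right (ℓ : EuclideanSpace ℝ (Fin d) → X → ℝ)
    (hproj : Measurable (proj K)) (σ η : ℝ) (D : Finset X) (w : EuclideanSpace ℝ (Fin d)) :
    Measurable fun b : Batch D × EuclideanSpace ℝ (Fin d) => stepMap ℓ K σ η b.1 w b.2 :=
  measurable_from_prod_countable_right fun B => measurable_stepMap_right ℓ hproj σ η B w

theorem lintegral_stepLaw (ℓ : EuclideanSpace ℝ (Fin d) → X → ℝ) (hproj : Measurable (proj K))
    (q σ η : ℝ) (D : Finset X) (w : EuclideanSpace ℝ (Fin d))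
    {φ : EuclideanSpace ℝ (Fin d) → ℝ≥0∞} (hφ : Measurable φ) :
    ∫⁻ y, φ y ∂(stepLaw ℓ K q σ η D w) = ∑ B ∈ D.powerset, batchWeight q D B *
      ∫⁻ z, φ (stepMap ℓ K σ η B w z) ∂(stdGaussian (EuclideanSpace ℝ (Fin d))) := by
  rw [stepLaw, lintegral_finsetSum_measure]
  refine Finset.sum_congr rfl fun B _ => ?_
  have hm := measurable_stepMap_right ℓ hproj σ η B w
  rw [lintegral_smul_measure, smul_eq_mul]
  exact congrArg _ (lintegral_map hφ hm)

theorem lintegral_stepLaw_eq_noiseLaw (ℓ : EuclideanSpace ℝ (Fin d) → X → ℝ)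
    (hproj : Measurable (proj K)) (q σ η : ℝ) (D : Finset X) (w : EuclideanSpace ℝ (Fin d))
    {φ : EuclideanSpace ℝ (Fin d) → ℝ≥0∞} (hφ : Measurable φ) :
    ∫⁻ y, φ y ∂(stepLaw ℓ K q σ η D w) =
      ∫⁻ b, φ (stepMap ℓ K σ η b.1 w b.2) ∂(noiseLaw d q D) := by
  rw [lintegral_stepLaw ℓ hproj q σ η D w hφ,
    lintegral_noiseLaw q D (f := fun b => φ (stepMap ℓ K σ η b.1 w b.2))
      (hφ.comp (measurable_stepMap_batch_right ℓ hproj σ η D w))]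
  exact (Finset.sum_coe_sort D.powerset fun B => batchWeight q D B *
    ∫⁻ z, φ (stepMap ℓ K σ η B w z) ∂(stdGaussian (EuclideanSpace ℝ (Fin d)))).symm

theorem stepMap_insert [DecidableEq X] (ℓ : EuclideanSpace ℝ (Fin d) → X → ℝ) {σ : ℝ}
    (hσ : σ ≠ 0) (η : ℝ) {B : Finset X} {x : X} (hx : x ∉ B) (w z : EuclideanSpace ℝ (Fin d)) :
    stepMap ℓ K σ η (insert x B) w z
      = stepMap ℓ K σ η B w (z + σ⁻¹ • ∇ (fun v => ℓ v x) w) := by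
  rw [stepMap, stepMap, Finset.sum_insert hx, smul_add σ, smul_inv_smul₀ hσ]
  congr 3
  abel

/-- Pair each batch `B` from `D` with `insert x B`: relative to the weight of `B` they carry `1 - q`
and `q`. The second is the first with translated noise, so together they give the mixture density.
-/
theorem lintegral_stepLaw_insert [DecidableEq X] (ℓ : EuclideanSpace ℝ (Fin d) → X → ℝ)
    (hproj : Measurable (proj K)) {q σ : ℝ} (hq0 : 0 ≤ q) (hq1 : q ≤ 1) (hσ : σ ≠ 0) (η : ℝ)
    {D : Finset X} {x : X} (hx : x ∉ D) (w : EuclideanSpace ℝ (Fin d))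
    {φ : EuclideanSpace ℝ (Fin d) → ℝ≥0∞} (hφ : Measurable φ) :
    ∫⁻ y, φ y ∂(stepLaw ℓ K q σ η (insert x D) w) =
      ∫⁻ b, mixDensity q (σ⁻¹ • ∇ (fun v => ℓ v x) w) b.2 *
        φ (stepMap ℓ K σ η b.1 w b.2) ∂(noiseLaw d q D) := by
  set a := σ⁻¹ • ∇ (fun v => ℓ v x) w
  have h1q : 0 ≤ 1 - q := by linarith
  have hmix : Measurable (mixDensity q a) := measurable_mixDensity_right q a
  have hshift : Measurable (shiftDensity a) := by
    unfold shiftDensity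
    fun_prop
  have hY : Measurable fun b : Batch D × EuclideanSpace ℝ (Fin d) =>
      φ (stepMap ℓ K σ η b.1 w b.2) :=
    hφ.comp (measurable_stepMap_batch_right ℓ hproj σ η D w)
  rw [lintegral_stepLaw ℓ hproj q σ η _ w hφ, Finset.sum_powerset_insert hx,
    ← Finset.sum_add_distrib,
    lintegral_noiseLaw q D
      (f := fun b => mixDensity q a b.2 * φ (stepMap ℓ K σ η b.1 w b.2))
      ((hmix.comp measurable_snd).mul hY)]
  rw [Finset.sum_coe_sort D.powerset fun B => batchWeight q D B *
    ∫⁻ z, mixDensity q a z * φ (stepMap ℓ K σ η B w z) ∂(stdGaussian (EuclideanSpace ℝ (Fin d)))]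
  refine Finset.sum_congr rfl fun B hB => ?_
  have hBD := Finset.mem_powerset.1 hB
  have hxB : x ∉ B := fun h => hx (hBD h)
  have hcard := Finset.card_le_card hBD
  have hφB : Measurable fun z => φ (stepMap ℓ K σ η B w z) :=
    hφ.comp (measurable_stepMap_right ℓ hproj σ η B w)
  have hw₁ : batchWeight q (insert x D) B = batchWeight q D B * ENNReal.ofReal (1 - q) := by
    rw [batchWeight, batchWeight, ← ENNReal.ofReal_mul (by positivity),
      Finset.card_insert_of_notMem hx, Nat.succ_sub hcard, pow_succ, mul_assoc]
  have hw₂ : batchWeight q (insert x D) (insert x B) = batchWeight q D B * ENNReal.ofReal q := by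
    rw [batchWeight, batchWeight, ← ENNReal.ofReal_mul (by positivity),
      Finset.card_insert_of_notMem hx, Finset.card_insert_of_notMem hxB, Nat.add_sub_add_right,
      pow_succ]
    congr 1
    ring
  -- Cameron-Martin turns the translation of the noise into a density.
  have hins : ∫⁻ z, φ (stepMap ℓ K σ η (insert x B) w z)
        ∂(stdGaussian (EuclideanSpace ℝ (Fin d)))
      = ∫⁻ z, shiftDensity a z * φ (stepMap ℓ K σ η B w z)
        ∂(stdGaussian (EuclideanSpace ℝ (Fin d))) := by
    have h := lintegral_withDensity_eq_lintegral_mul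
      (stdGaussian (EuclideanSpace ℝ (Fin d))) hshift hφB
    rw [← map_add_const_stdGaussian, lintegral_map hφB (by fun_prop)] at h
    simp only [stepMap_insert ℓ hσ η hxB]
    exact h
  rw [hw₁, hw₂, hins, mul_assoc, mul_assoc, ← mul_add]
  congr 1
  simp only [mixDensity, add_mul, mul_assoc]
  rw [lintegral_add_left (hφB.const_mul _), lintegral_const_mul' _ _ ENNReal.ofReal_ne_top,
    lintegral_const_mul' _ _ ENNReal.ofReal_ne_top]

theorem measurable_stepLaw (ℓ : EuclideanSpace ℝ (Fin d) → X → ℝ) (hproj : Measurable (proj K))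
    {q : ℝ} (hq0 : 0 ≤ q) (hq1 : q ≤ 1) (σ η : ℝ) (D : Finset X) :
    Measurable (stepLaw ℓ K q σ η D) := by
  have := isProbabilityMeasure_noiseLaw (d := d) hq0 hq1 D
  refine Measure.measurable_of_measurable_coe _ fun s hs => ?_
  have hind : Measurable (s.indicator (1 : EuclideanSpace ℝ (Fin d) → ℝ≥0∞)) :=
    measurable_one.indicator hs
  have h : ∀ w, stepLaw ℓ K q σ η D w s = ∫⁻ b, s.indicator 1 (stepMap ℓ K σ η b.1 w b.2)
      ∂(noiseLaw d q D) := fun w => by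
    rw [← lintegral_stepLaw_eq_noiseLaw ℓ hproj q σ η D w hind, lintegral_indicator_one hs]
  simp only [h]
  have hcomp : Measurable fun a : EuclideanSpace ℝ (Fin d) × (Batch D × EuclideanSpace ℝ (Fin d)) =>
      s.indicator (1 : EuclideanSpace ℝ (Fin d) → ℝ≥0∞) (stepMap ℓ K σ η a.2.1 a.1 a.2.2) :=
    hind.comp (measurable_stepMap_batch ℓ hproj σ η D)
  exact hcomp.lintegral_prod_right'

theorem bind_stepLaw (ℓ : EuclideanSpace ℝ (Fin d) → X → ℝ) (hproj : Measurable (proj K))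
    {q : ℝ} (hq0 : 0 ≤ q) (hq1 : q ≤ 1) (σ η : ℝ) (D : Finset X)
    (ν : Measure (EuclideanSpace ℝ (Fin d))) [SFinite ν] :
    ν.bind (stepLaw ℓ K q σ η D) = (ν.prod (noiseLaw d q D)).map
      (fun a => stepMap ℓ K σ η a.2.1 a.1 a.2.2) := by
  have := isProbabilityMeasure_noiseLaw (d := d) hq0 hq1 D
  have hY := measurable_stepMap_batch ℓ hproj σ η D
  refine Measure.ext_of_lintegral _ fun φ hφ => ?_
  have hφY : Measurable fun a : EuclideanSpace ℝ (Fin d) × (Batch D × EuclideanSpace ℝ (Fin d)) =>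
      φ (stepMap ℓ K σ η a.2.1 a.1 a.2.2) := hφ.comp hY
  rw [Measure.lintegral_bind (measurable_stepLaw ℓ hproj hq0 hq1 σ η D).aemeasurable
    hφ.aemeasurable, lintegral_map hφ hY, lintegral_prod _ hφY.aemeasurable]
  exact lintegral_congr fun w => lintegral_stepLaw_eq_noiseLaw ℓ hproj q σ η D w hφ

theorem measurable_mixDensity_gradient (ℓ : EuclideanSpace ℝ (Fin d) → X → ℝ) (q σ : ℝ) (x : X)
    (D : Finset X) :
    Measurable fun a : EuclideanSpace ℝ (Fin d) × (Batch D × EuclideanSpace ℝ (Fin d)) =>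
      mixDensity q (σ⁻¹ • ∇ (fun v => ℓ v x) a.1) a.2.2 := by
  have hgrad := measurable_gradient (fun v => ℓ v x)
  exact (measurable_mixDensity q).comp
    (f := fun a : EuclideanSpace ℝ (Fin d) × (Batch D × EuclideanSpace ℝ (Fin d)) =>
      (σ⁻¹ • ∇ (fun v => ℓ v x) a.1, a.2.2)) (by fun_prop)

theorem bind_stepLaw_insert [DecidableEq X] (ℓ : EuclideanSpace ℝ (Fin d) → X → ℝ)
    (hproj : Measurable (proj K)) {q σ : ℝ} (hq0 : 0 ≤ q) (hq1 : q ≤ 1) (hσ : σ ≠ 0) (η : ℝ)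
    {D : Finset X} {x : X} (hx : x ∉ D) (μ : Measure (EuclideanSpace ℝ (Fin d))) [SFinite μ] :
    μ.bind (stepLaw ℓ K q σ η (insert x D)) = ((μ.prod (noiseLaw d q D)).withDensity
      (fun a => mixDensity q (σ⁻¹ • ∇ (fun v => ℓ v x) a.1) a.2.2)).map
      (fun a => stepMap ℓ K σ η a.2.1 a.1 a.2.2) := by
  have := isProbabilityMeasure_noiseLaw (d := d) hq0 hq1 D
  have hY := measurable_stepMap_batch ℓ hproj σ η D
  have hh := measurable_mixDensity_gradient ℓ q σ x D
  refine Measure.ext_of_lintegral _ fun φ hφ => ?_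
  have hφY : Measurable fun a : EuclideanSpace ℝ (Fin d) × (Batch D × EuclideanSpace ℝ (Fin d)) =>
      φ (stepMap ℓ K σ η a.2.1 a.1 a.2.2) := hφ.comp hY
  rw [Measure.lintegral_bind (measurable_stepLaw ℓ hproj hq0 hq1 σ η _).aemeasurable
    hφ.aemeasurable, lintegral_map hφ hY,
    lintegral_withDensity_eq_lintegral_mul _ hh hφY]
  rw [lintegral_prod _ (hh.mul hφY).aemeasurable]
  exact lintegral_congr fun w => lintegral_stepLaw_insert ℓ hproj hq0 hq1 hσ η hx w hφ

theorem isProbabilityMeasure_iterLaw (ℓ : EuclideanSpace ℝ (Fin d) → X → ℝ)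
    (hproj : Measurable (proj K)) {q : ℝ} (hq0 : 0 ≤ q) (hq1 : q ≤ 1) (σ : ℝ) (η : ℕ → ℝ)
    (ν₀ : Measure (EuclideanSpace ℝ (Fin d))) [IsProbabilityMeasure ν₀] (D : Finset X) (t : ℕ) :
    IsProbabilityMeasure (iterLaw ℓ K q σ η ν₀ D t) := by
  induction t with
  | zero => rw [iterLaw]; infer_instance
  | succ t ih =>
    have := isProbabilityMeasure_noiseLaw (d := d) hq0 hq1 D
    rw [iterLaw, bind_stepLaw ℓ hproj hq0 hq1]
    exact Measure.isProbabilityMeasure_map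
      (measurable_stepMap_batch ℓ hproj σ (η t) D).aemeasurable

theorem measurable_binomialMoment (q σ : ℝ) (n : ℕ) : Measurable (binomialMoment q σ n) := by
  unfold binomialMoment
  fun_prop

/-- One step of projected noisy gradient descent on two datasets that differ in the point `x`. -/
theorem stepLaw_moment_bound [DecidableEq X] (ℓ : EuclideanSpace ℝ (Fin d) → X → ℝ)
    (hproj : Measurable (proj K)) {q σ : ℝ} (hq0 : 0 ≤ q) (hq1 : q ≤ 1) (hσ : σ ≠ 0) (η : ℝ)
    {D : Finset X} {x : X} (hx : x ∉ D) {μ ν : Measure (EuclideanSpace ℝ (Fin d))}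
    [IsProbabilityMeasure μ] [IsProbabilityMeasure ν] (hac : μ ≪ ν) {α p : ℝ} (hα : 1 < α)
    (hp : 1 < p) {n : ℕ} (hn : α ≤ n) :
    μ.bind (stepLaw ℓ K q σ η (insert x D)) ≪ ν.bind (stepLaw ℓ K q σ η D) ∧
      ∫⁻ y, ((μ.bind (stepLaw ℓ K q σ η (insert x D))).rnDeriv
          (ν.bind (stepLaw ℓ K q σ η D)) y) ^ α ∂(ν.bind (stepLaw ℓ K q σ η D))
        ≤ (∫⁻ w, ENNReal.ofReal (binomialMoment q σ n ‖∇ (fun v => ℓ v x) w‖) ^ p ∂μ) ^ (1 / p) *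
          (∫⁻ w, (μ.rnDeriv ν w) ^ (1 + (α - 1) * (p / (p - 1))) ∂ν) ^ ((p - 1) / p) := by
  have := isProbabilityMeasure_noiseLaw (d := d) hq0 hq1 D
  rw [bind_stepLaw ℓ hproj hq0 hq1 σ η D ν, bind_stepLaw_insert ℓ hproj hq0 hq1 hσ η hx]
  refine noisyStep_bound hac (measurable_stepMap_batch ℓ hproj σ η D)
    (measurable_mixDensity_gradient ℓ q σ x D) (fun w => ?_) hα hp ?_ (fun w => ?_)
  · dsimp only
    rw [lintegral_noiseLaw_snd hq0 hq1 D (measurable_mixDensity_right q _),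
      lintegral_mixDensity hq0 hq1]
  · exact ((measurable_binomialMoment q σ n).comp (measurable_gradient _).norm).ennreal_ofReal
  · rw [lintegral_noiseLaw_snd hq0 hq1 D
      (f := fun z => mixDensity q (σ⁻¹ • ∇ (fun v => ℓ v x) w) z ^ α)
      ((measurable_mixDensity_right q _).pow_const α)]
    exact lintegral_mixDensity_rpow_le hq0 hq1 σ hα.le hn _

end

end Iteration

/-! ### Arithmetic of the orders and coefficients -/

section Orders

theorem le_orderMap {p α : ℝ} (hp : 1 < p) (hα : 1 ≤ α) : α ≤ orderMap p α := by
  have hp1 : 0 < p - 1 := by linarith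
  have h : orderMap p α - α = α / (p - 1) - 1 / p := by
    rw [orderMap]
    field_simp
    ring
  have : 1 / p ≤ α / (p - 1) := by
    rw [div_le_div_iff₀ (by linarith) hp1]
    nlinarith
  linarith

theorem monotone_orderMap {p : ℝ} (hp : 1 < p) : Monotone (orderMap p) := by
  intro a b hab
  have : 0 ≤ p / (p - 1) := div_nonneg (by linarith) (by linarith)
  simp only [orderMap]
  gcongr

/-- The order produced by Hölder falls short of `o_p(α)` by exactly `1/(p-1) - 1/p`. -/
theorem one_add_mul_le_orderMap {p α : ℝ} (hp : 1 < p) :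
    1 + (α - 1) * (p / (p - 1)) ≤ orderMap p α := by
  have hp1 : 0 < p - 1 := by linarith
  have h : orderMap p α - (1 + (α - 1) * (p / (p - 1))) = 1 / (p - 1) - 1 / p := by
    rw [orderMap]
    field_simp
    ring
  have : 1 / p ≤ 1 / (p - 1) := one_div_le_one_div_of_le hp1 (by linarith)
  linarith

theorem order_le_order_succ {p α β : ℝ} (hp : 1 < p) (h : β ≤ orderMap p α) (t : ℕ) :
    order p β t ≤ order p α (t + 1) := by
  rw [order, order, Function.iterate_succ_apply]
  exact Nat.ceil_le_ceil ((monotone_orderMap hp).iterate t h)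

theorem le_order_one {p α : ℝ} (hp : 1 < p) (hα : 1 ≤ α) : α ≤ order p α 1 :=
  (le_orderMap hp hα).trans (Nat.le_ceil _)

theorem one_le_order {p α : ℝ} (hp : 1 < p) (hα : 1 ≤ α) (t : ℕ) : 1 ≤ order p α t := by
  have h : ∀ t, 1 ≤ (orderMap p)^[t] α := by
    intro t
    induction t with
    | zero => simpa using hα
    | succ t ih =>
      rw [Function.iterate_succ_apply']
      exact ih.trans (le_orderMap hp ih)
  exact Nat.one_le_ceil_iff.2 (by linarith [h t])

/-- Passing to the new order multiplies `α - 1` by `p/(p-1)`, which supplies exactly one more factor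
`(p-1)/p`. -/
theorem stepCoeff_succ {p α : ℝ} (hp : 1 < p) (hα : 1 < α) (t : ℕ) :
    stepCoeff p (1 + (α - 1) * (p / (p - 1))) t = stepCoeff p α (t + 1) := by
  have hp0 : p ≠ 0 := by linarith
  have hp1 : p - 1 ≠ 0 := by linarith
  have hα1 : α - 1 ≠ 0 := by linarith
  rw [stepCoeff, stepCoeff, add_sub_cancel_left]
  field_simp
  ring

theorem stepCoeff_nonneg {p α : ℝ} (hp : 1 < p) (hα : 1 < α) (t : ℕ) : 0 ≤ stepCoeff p α t := by
  have hp1 : 0 < p - 1 := by linarith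
  have hα1 : 0 < α - 1 := by linarith
  rw [stepCoeff]
  positivity

/-- This is where `p ≥ 3` enters: it gives `p ≤ (p-1)²`. -/
theorem one_div_mul_one_div_le_stepCoeff_one {p α : ℝ} (hp : 3 ≤ p) (hα : 1 < α) :
    1 / (α - 1) * (1 / p) ≤ stepCoeff p α 1 := by
  have hα1 : 0 < α - 1 := by linarith
  rw [stepCoeff]
  refine mul_le_mul_of_nonneg_left ?_ (by positivity)
  rw [one_add_one_eq_two, div_le_div_iff₀ (by linarith) (by positivity)]
  have h : p ≤ (p - 1) ^ 2 := by nlinarith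
  have := mul_le_mul_of_nonneg_right h (show 0 ≤ p by linarith)
  linarith

end Orders

/-! ### Monotonicity of the binomial moments in the order -/

section Moments

variable {d : ℕ}

/-- Both sides are moments, of order at least one, of the same probability density `mixDensity`. -/
theorem binomialMoment_mono {q : ℝ} (hq0 : 0 ≤ q) (hq1 : q ≤ 1) (σ : ℝ) {m n : ℕ} (hm : 1 ≤ m)
    (hmn : m ≤ n) (v : EuclideanSpace ℝ (Fin d)) :
    ENNReal.ofReal (binomialMoment q σ m ‖v‖) ≤ ENNReal.ofReal (binomialMoment q σ n ‖v‖) := by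
  rw [← lintegral_mixDensity_pow hq0 hq1]
  simp only [← ENNReal.rpow_natCast]
  exact lintegral_mixDensity_rpow_le hq0 hq1 σ (by exact_mod_cast hm) (by exact_mod_cast hmn) v

theorem binomialMoment_nonneg {q : ℝ} (hq0 : 0 ≤ q) (hq1 : q ≤ 1) (σ : ℝ) (n : ℕ) (g : ℝ) :
    0 ≤ binomialMoment q σ n g := by
  have : 0 ≤ 1 - q := by linarith
  unfold binomialMoment
  positivity

theorem one_le_binomialMoment {q : ℝ} (hq0 : 0 ≤ q) (hq1 : q ≤ 1) (σ : ℝ) {n : ℕ} (hn : 1 ≤ n)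
    (v : EuclideanSpace ℝ (Fin d)) : 1 ≤ ENNReal.ofReal (binomialMoment q σ n ‖v‖) := by
  refine le_trans ?_ (binomialMoment_mono hq0 hq1 σ le_rfl hn v)
  rw [← lintegral_mixDensity_pow hq0 hq1]
  simp only [pow_one]
  rw [lintegral_mixDensity hq0 hq1]

theorem ofReal_stepMoment {q : ℝ} (hq0 : 0 ≤ q) (hq1 : q ≤ 1) {p : ℝ} (hp : 0 ≤ p) (σ α : ℝ)
    (t : ℕ) (g : ℝ) : ENNReal.ofReal (stepMoment p q σ α t g)
      = ENNReal.ofReal (binomialMoment q σ (order p α t) g) ^ p := by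
  rw [ENNReal.ofReal_rpow_of_nonneg (binomialMoment_nonneg hq0 hq1 σ _ g) hp]
  rfl

end Moments

theorem renyiDiv_of_absolutelyContinuous {Ω : Type*} [MeasurableSpace Ω] (α : ℝ)
    {μ ν : Measure Ω} (h : μ ≪ ν) : renyiDiv α μ ν =
      ((1 / (α - 1) : ℝ) : EReal) * ENNReal.log (∫⁻ x, (μ.rnDeriv ν x) ^ α ∂ν) :=
  if_pos h

theorem renyiDiv_self {Ω : Type*} [MeasurableSpace Ω] (α : ℝ) (μ : Measure Ω)
    [IsProbabilityMeasure μ] : renyiDiv α μ μ = 0 := by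
  have h : ∫⁻ x, (μ.rnDeriv μ x) ^ α ∂μ = 1 := by
    rw [lintegral_congr_ae (g := fun _ => 1), lintegral_one, measure_univ]
    filter_upwards [Measure.rnDeriv_self μ] with x hx
    rw [hx]
    simp
  rw [renyiDiv_of_absolutelyContinuous α Measure.AbsolutelyContinuous.rfl, h, ENNReal.log_one,
    mul_zero]

/-! ### Induction over the steps -/

section PrivacyLoss

variable {d : ℕ} {X : Type*} [DecidableEq X] {K : Set (EuclideanSpace ℝ (Fin d))}

/-- Here `p` is independent of `t`, so it stays fixed during the induction. The order must vary,
since the bound at `α` uses the previous one at `α'`; absolute continuity is carried along because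
the one-step bound requires it. -/
theorem renyiDiv_iterLaw_insert_le (ℓ : EuclideanSpace ℝ (Fin d) → X → ℝ)
    (hproj : Measurable (proj K)) {q σ : ℝ} (hq0 : 0 ≤ q) (hq1 : q ≤ 1) (hσ : σ ≠ 0) (η : ℕ → ℝ)
    (ν₀ : Measure (EuclideanSpace ℝ (Fin d))) [IsProbabilityMeasure ν₀]
    {D : Finset X} {x : X} (hx : x ∉ D) {p : ℝ} (hp : 3 ≤ p) (t : ℕ) :
    iterLaw ℓ K q σ η ν₀ (insert x D) t ≪ iterLaw ℓ K q σ η ν₀ D t ∧ ∀ α : ℝ, 1 < α →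
      renyiDiv α (iterLaw ℓ K q σ η ν₀ (insert x D) t) (iterLaw ℓ K q σ η ν₀ D t)
        ≤ ∑ s ∈ Finset.Icc 1 t, (stepCoeff p α s : EReal) *
          ENNReal.log (∫⁻ w, ENNReal.ofReal (stepMoment p q σ α s ‖∇ (fun v => ℓ v x) w‖)
            ∂(iterLaw ℓ K q σ η ν₀ (insert x D) (t - s))) := by
  have hp1 : 1 < p := by linarith
  have hp0 : 0 < p := by linarith
  induction t with
  | zero =>
    refine ⟨Measure.AbsolutelyContinuous.rfl, fun α _ => ?_⟩
    simp only [iterLaw]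
    rw [renyiDiv_self]
    simp
  | succ t ih =>
    obtain ⟨hac, ih⟩ := ih
    have hμ := isProbabilityMeasure_iterLaw ℓ hproj hq0 hq1 σ η ν₀ (insert x D) t
    have hν := isProbabilityMeasure_iterLaw ℓ hproj hq0 hq1 σ η ν₀ D t
    have step := fun (α : ℝ) (hα : 1 < α) => stepLaw_moment_bound ℓ hproj hq0 hq1 hσ (η t) hx
      hac hα hp1 (le_order_one hp1 hα.le)
    have hac' : iterLaw ℓ K q σ η ν₀ (insert x D) (t + 1) ≪ iterLaw ℓ K q σ η ν₀ D (t + 1) :=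
      -- Absolute continuity does not involve the order; any value above one serves.
      (step 2 one_lt_two).1
    refine ⟨hac', fun α hα => ?_⟩
    have hα1 : 0 < α - 1 := by linarith
    set α' := 1 + (α - 1) * (p / (p - 1)) with hα'
    have hα'1 : 1 < α' := by
      have : 0 < (α - 1) * (p / (p - 1)) := mul_pos hα1 (div_pos hp0 (by linarith))
      linarith
    set F := ∫⁻ w, ENNReal.ofReal (stepMoment p q σ α 1 ‖∇ (fun v => ℓ v x) w‖)
      ∂(iterLaw ℓ K q σ η ν₀ (insert x D) t)
    -- Makes `log F` nonnegative, so its coefficient may be enlarged to `stepCoeff p α 1`.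
    have hF : 1 ≤ F := by
      calc (1 : ℝ≥0∞) = ∫⁻ _, 1 ∂(iterLaw ℓ K q σ η ν₀ (insert x D) t) := by simp
        _ ≤ F := lintegral_mono fun w => by
          rw [ofReal_stepMoment hq0 hq1 hp0.le]
          exact ENNReal.one_le_rpow
            (one_le_binomialMoment hq0 hq1 σ (one_le_order hp1 hα.le 1) _) hp0
    have hstep : renyiDiv α (iterLaw ℓ K q σ η ν₀ (insert x D) (t + 1))
        (iterLaw ℓ K q σ η ν₀ D (t + 1)) ≤ (stepCoeff p α 1 : EReal) * ENNReal.log F +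
          renyiDiv α' (iterLaw ℓ K q σ η ν₀ (insert x D) t) (iterLaw ℓ K q σ η ν₀ D t) := by
      rw [renyiDiv_of_absolutelyContinuous α hac', renyiDiv_of_absolutelyContinuous α' hac]
      have hbound := (step α hα).2
      simp only [← ofReal_stepMoment hq0 hq1 hp0.le] at hbound
      refine (mul_le_mul_of_nonneg_left (ENNReal.log_le_log hbound)
        (EReal.coe_nonneg.2 (by positivity))).trans ?_
      rw [ENNReal.log_mul_add, ENNReal.log_rpow, ENNReal.log_rpow,
        EReal.left_distrib_of_nonneg_of_ne_top (EReal.coe_nonneg.2 (by positivity))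
          (EReal.coe_ne_top _), ← mul_assoc, ← mul_assoc, ← EReal.coe_mul, ← EReal.coe_mul]
      have hcoeff : 1 / (α - 1) * ((p - 1) / p) = 1 / (α' - 1) := by
        have : p - 1 ≠ 0 := by linarith
        rw [hα', add_sub_cancel_left]
        field_simp
      rw [hcoeff]
      gcongr
      · exact ENNReal.zero_le_log_iff.2 hF
      · exact one_div_mul_one_div_le_stepCoeff_one hp hα
    refine hstep.trans ?_
    -- The index counts from the end: `s = 1` is the newest step, and the older ones move up by one.
    have hsum : ∀ f : ℕ → EReal,
        ∑ s ∈ Finset.Icc 1 (t + 1), f s = f 1 + ∑ s ∈ Finset.Icc 1 t, f (s + 1) := by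
      intro f
      rw [← Finset.add_sum_Ioc_eq_sum_Icc (by omega)]
      congr 1
      rw [← Finset.sum_image (f := f) (g := fun s => s + 1) (by simp)]
      congr 1
      ext s
      simp only [Finset.mem_Ioc, Finset.mem_image, Finset.mem_Icc]
      exact ⟨fun h => ⟨s - 1, by omega, by omega⟩, by rintro ⟨a, ha, rfl⟩; omega⟩
    rw [hsum]
    refine add_le_add le_rfl ((ih α' hα'1).trans (Finset.sum_le_sum fun s _ => ?_))
    rw [hα', stepCoeff_succ hp1 hα, Nat.add_sub_add_right]
    refine mul_le_mul_of_nonneg_left (ENNReal.log_le_log (lintegral_mono fun w => ?_))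
      (EReal.coe_nonneg.2 (stepCoeff_nonneg hp1 hα _))
    rw [ofReal_stepMoment hq0 hq1 hp0.le, ofReal_stepMoment hq0 hq1 hp0.le]
    exact ENNReal.rpow_le_rpow (binomialMoment_mono hq0 hq1 σ (one_le_order hp1 hα'1.le s)
      (order_le_order_succ hp1 (one_add_mul_le_orderMap hp1) s) _) hp0.le

end PrivacyLoss

end PerInstance

end

theorem theorem1 {d : ℕ} {X : Type*} [DecidableEq X]
    (ℓ : EuclideanSpace ℝ (Fin d) → X → ℝ)
    (hℓ : ∀ x, Differentiable ℝ (fun w => ℓ w x))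
    (K : Set (EuclideanSpace ℝ (Fin d))) (hK_ne : K.Nonempty) (hK_closed : IsClosed K)
    (hK_convex : Convex ℝ K)
    (q : ℝ) (hq_nonneg : 0 ≤ q) (hq_le : q ≤ 1)
    (σ : ℝ) (hσ : 0 < σ)
    (η : ℕ → ℝ)
    (ν₀ : Measure (EuclideanSpace ℝ (Fin d))) (hν₀ : IsProbabilityMeasure ν₀)
    (T : ℕ) (D : Finset X) (x : X) (hx : x ∈ D)
    (α : ℝ) (hα : 1 < α) :
    PerInstance.iterLaw ℓ K q σ η ν₀ D T ≪ PerInstance.iterLaw ℓ K q σ η ν₀ (D.erase x) T ∧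
    PerInstance.renyiDiv α
        (PerInstance.iterLaw ℓ K q σ η ν₀ D T)
        (PerInstance.iterLaw ℓ K q σ η ν₀ (D.erase x) T)
      ≤ PerInstance.privacyLoss ℓ K q σ η ν₀ D T x α := by
  have hproj := PerInstance.measurable_proj hK_ne hK_closed hK_convex
  -- For `T = 0` the exponent `p = 3T` degenerates, but both laws are `ν₀` and the sum is empty.
  rcases Nat.eq_zero_or_pos T with rfl | hT
  · simp only [PerInstance.iterLaw, PerInstance.privacyLoss]
    refine ⟨Measure.AbsolutelyContinuous.rfl, ?_⟩
    rw [PerInstance.renyiDiv_self]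
    simp
  · have hp : (3 : ℝ) ≤ 3 * T := by
      have : (1 : ℝ) ≤ T := by exact_mod_cast hT
      linarith
    obtain ⟨hac, h⟩ := PerInstance.renyiDiv_iterLaw_insert_le ℓ hproj hq_nonneg hq_le hσ.ne' η ν₀
      (Finset.notMem_erase x D) hp T
    rw [Finset.insert_erase hx] at hac h
    exact ⟨hac, h α hα⟩
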